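/- Let $G$ be a Hausdorff topological group acting continuously on a compact Hausdorff space $X$, and suppose that the action is minimal (every orbit is dense). For $n\ge 1$ let $\mathcal{HK}^{[n]}$ be the subgroup of $G^{\{0,1\}^n}$ generated by the elements $[h]_F$, where $h\in G$, $F=\{\omega\in\{0,1\}^n:\omega_i=a\}$ is a hyperface ($1\le i\le n$, $a\in\{0,1\}$), and $[h]_F(\omega)=h$ for $\omega\in F$, $[h]_F(\omega)=\mathrm{Id}$ otherwise. Put $$C_G^{[n]}(X)=\overline{\{(\gamma(\omega)x)_{\omega\in\{0,1\}^n}:\gamma\in\mathcal{HK}^{[n]},\ x\in X\}}\subseteq X^{\{0,1\}^n}.$$ For $d\ge 1$ let $\mathrm{NRP}^{[d]}(X)$ be the set of pairs $(x,y)\in X\times X$ such that the configuration in $X^{\{0,1\}^{d+1}}$ with value $y$ at $\vec 1=(1,\dots,1)$ and value $x$ at every other vertex belongs to $C_G^{[d+1]}(X)$. A system $(G,Y)$ (a continuous action of $G$ on a compact Hausdorff space $Y$) is called of order at most $d$ if $\mathrm{NRP}^{[d]}(Y)$, defined in the same way, is the diagonal of $Y\times Y$. A factor map is a continuous $G$-equivariant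 surjection between systems. Let $d\ge 1$. Then $\mathrm{NRP}^{[d]}(X)$ is an equivalence relation; the quotient space $X/\mathrm{NRP}^{[d]}(X)$, with the induced action of $G$, is a system (it is compact Hausdorff and the action is well defined and continuous); the quotient map $\pi_d\colon X\to X/\mathrm{NRP}^{[d]}(X)$ is a factor map; and $(G,X/\mathrm{NRP}^{[d]}(X))$ is the maximal factor of $(G,X)$ of order at most $d$, that is: 1. $\mathrm{NRP}^{[d]}\big(X/\mathrm{NRP}^{[d]}(X)\big)$ is the diagonal, so $(G,X/\mathrm{NRP}^{[d]}(X))$ is a system of order at most $d$; 2. if $\phi\colon (G,X)\to(G,Y)$ is a factor map onto a system $(G,Y)$ of order at most $d$, then there is a factor map $\psi\colon (G,X/\mathrm{NRP}^{[d]}(X))\to(G,Y)$ with $\phi=\psi\circ\pi_d$. -/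

import Mathlib

namespace NilRP

/-- The discrete cube `{0,1}ⁿ`; `false` stands for `0` and `true` for `1`. -/
abbrev Cube (n : ℕ) : Type := Fin n → Bool

/-- The hyperface `{ω | ω i = a}` of the discrete cube. -/
def hyperface {n : ℕ} (i : Fin n) (a : Bool) : Set (Cube n) := {ω | ω i = a}

open Classical in
/-- The element `[h]_F` of `G^{[n]}`, equal to `h` on `F` and to the identity off `F`. -/
noncomputable def faceElement {G : Type*} [Group G] {n : ℕ} (F : Set (Cube n)) (h : G) :
    Cube n → G :=
  fun ω => if ω ∈ F then h else 1

/-- The Host–Kra cube group: the subgroup of `G^{[n]}` generated by all `[h]_F`, with `h ∈ G`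
and `F` a hyperface of `{0,1}ⁿ`. -/
def hostKraGroup (G : Type*) [Group G] (n : ℕ) : Subgroup (Cube n → G) :=
  Subgroup.closure {γ | ∃ (i : Fin n) (a : Bool) (h : G), γ = faceElement (hyperface i a) h}

/-- The dynamical cubes: the closure, in the product topology on `X^{[n]}`, of the set of
configurations `γ x^{[n]}` with `γ` in the Host–Kra cube group and `x ∈ X`. -/
def dynamicalCubes (G X : Type*) [Group G] [TopologicalSpace X] [MulAction G X] (n : ℕ) :
    Set (Cube n → X) :=
  closure {c | ∃ γ ∈ hostKraGroup G n, ∃ x : X, c = fun ω => γ ω • x}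

/-- The lower corner: the value is `y` at the vertex `(1, …, 1)` and `x` at all other vertices. -/
def lowerCorner {X : Type*} (n : ℕ) (x y : X) : Cube n → X :=
  fun ω => if ω = (fun _ => true) then y else x

/-- The nilpotent regionally proximal relation of order `d`. -/
def NRP (G X : Type*) [Group G] [TopologicalSpace X] [MulAction G X] (d : ℕ) (x y : X) : Prop :=
  lowerCorner (d + 1) x y ∈ dynamicalCubes G X (d + 1)

/-- `(G, X)` is a system of order at most `d`: the relation `NRP^{[d]}(X)` is the diagonal. -/
def IsOfOrderAtMost (G X : Type*) [Group G] [TopologicalSpace X] [MulAction G X] (d : ℕ) : Prop :=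
  ∀ x y : X, NRP G X d x y ↔ x = y

/-- A factor map: a continuous `G`-equivariant surjection. -/
structure IsFactorMap (G : Type*) {X Y : Type*} [Group G] [TopologicalSpace X] [MulAction G X]
    [TopologicalSpace Y] [MulAction G Y] (f : X → Y) : Prop where
  continuous : Continuous f
  map_smul : ∀ (g : G) (x : X), f (g • x) = g • f x
  surjective : Function.Surjective f

/-- The constant elements `g^{[n]}`, `n ≥ 1`, lie in the Host–Kra cube group. -/
theorem const_mem_hostKraGroup {G : Type*} [Group G] (n : ℕ) (g : G) :
    (fun _ => g) ∈ hostKraGroup G (n + 1) := by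
  have h : (fun _ => g : Cube (n + 1) → G)
      = faceElement (hyperface 0 false) g * faceElement (hyperface 0 true) g := by
    funext ω
    cases hω : ω 0 <;> simp [faceElement, hyperface, hω]
  rw [h]
  exact mul_mem (Subgroup.subset_closure ⟨0, false, g, rfl⟩)
    (Subgroup.subset_closure ⟨0, true, g, rfl⟩)

/-- The relation `NRP^{[d]}(X)` is `G`-invariant. -/
theorem NRP.smul {G X : Type*} [Group G] [TopologicalSpace X] [MulAction G X]
    [ContinuousConstSMul G X] {d : ℕ} {x y : X} (h : NRP G X d x y) (g : G) :
    NRP G X d (g • x) (g • y) := by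
  have hcont : Continuous fun c : Cube (d + 1) → X => fun ω => g • c ω := by fun_prop
  have hmaps : Set.MapsTo (fun c : Cube (d + 1) → X => fun ω => g • c ω)
      {c | ∃ γ ∈ hostKraGroup G (d + 1), ∃ x : X, c = fun ω => γ ω • x}
      {c | ∃ γ ∈ hostKraGroup G (d + 1), ∃ x : X, c = fun ω => γ ω • x} := by
    rintro c ⟨γ, hγ, z, rfl⟩
    exact ⟨(fun _ => g) * γ, mul_mem (const_mem_hostKraGroup d g) hγ, z, by
      funext ω
      simp [mul_smul]⟩
  have key := hmaps.closure hcont h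
  have hcorner : lowerCorner (d + 1) (g • x) (g • y)
      = fun ω => g • lowerCorner (d + 1) x y ω := by
    funext ω
    simp only [lowerCorner]
    split_ifs <;> rfl
  unfold NRP
  rw [hcorner]
  exact key

section Quotient

variable {G X : Type*} [Group G] [TopologicalSpace X] [MulAction G X] {d : ℕ}

/-- The quotient space `X / NRP^{[d]}(X)`, available once `NRP^{[d]}(X)` is known to be an
equivalence relation. -/
def NRPQuotient (h : Equivalence (NRP G X d)) : Type _ := Quotient (Setoid.mk (NRP G X d) h)

/-- The quotient map `π_d : X → X / NRP^{[d]}(X)`. -/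
def NRPQuotient.mk (h : Equivalence (NRP G X d)) (x : X) : NRPQuotient h :=
  Quotient.mk (Setoid.mk (NRP G X d) h) x

/-- The quotient topology. -/
instance (h : Equivalence (NRP G X d)) : TopologicalSpace (NRPQuotient h) :=
  inferInstanceAs (TopologicalSpace (Quotient (Setoid.mk (NRP G X d) h)))

/-- The induced action, `g • π_d x = π_d (g • x)`. -/
instance [ContinuousConstSMul G X] (h : Equivalence (NRP G X d)) :
    MulAction G (NRPQuotient h) where
  smul g := Quotient.map (g • ·) fun _ _ hxy => NRP.smul hxy g
  one_smul := by
    rintro ⟨x⟩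
    exact congrArg (NRPQuotient.mk h) (one_smul G x)
  mul_smul := by
    rintro a b ⟨x⟩
    exact congrArg (NRPQuotient.mk h) (mul_smul a b x)

end Quotient

end NilRP

/-!
Let `w` be a minimal idempotent of the enveloping semigroup of `(G, X)`. The enveloping semigroup of
the Host–Kra cube group acts coordinatewise on configurations and carries any constant configuration
onto any dynamical cube; the constant tuple `w` is again a minimal idempotent of it, so its elements
`w t w` are invertible relative to `w`. Hence a dynamical cube `c` all of whose values are fixed by
`w` is the image of a constant cube under an element invertible relative to `w`, and transporting an
`NRP`-pair back and forth along that element shows that a vertex of `c` may be moved to any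
`NRP`-related point fixed by `w`. Moving all vertices one after another gives: if the values of a
dynamical cube are `NRP`-related to those of the lower corner of `(x, y)`, then `x` and `y` are
`NRP`-related. Here one chooses `w` fixing `x`; since it need not fix `y`, one first obtains the
pair `(x, w y)` and then replaces `w y` by `y` with the help of lower hyperfaces. Symmetry and
transitivity of `NRP` are special cases, and so is the statement that the quotient has order at most
`d`, because dynamical cubes of the quotient lift to `X`.
-/

namespace NilRP

open Set Function MulOpposite

section MinimalIdempotent

variable {M σ : Type*} [Semigroup M] [SetLike σ M]

/-- Idempotents of the subsemigroup `E` that are minimal for the preorder in which `e` lies below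
`w` when `e * w = e`. -/
structure IsMinimalIdempotent (E : σ) (w : M) : Prop where
  mem : w ∈ E
  isIdempotentElem : IsIdempotentElem w
  mul_eq_of_mul_eq : ∀ e ∈ E, IsIdempotentElem e → e * w = e → w * e = w

variable {E : σ} {w : M}

theorem IsMinimalIdempotent.of_mul_eq (hw : IsMinimalIdempotent E w) {v : M} (hvE : v ∈ E)
    (hv : IsIdempotentElem v) (hvw : v * w = v) : IsMinimalIdempotent E v where
  mem := hvE
  isIdempotentElem := hv
  mul_eq_of_mul_eq e he hee hev := by
    have hew : e * w = e := by rw [← hev, mul_assoc, hvw]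
    rw [← hvw, mul_assoc, hw.mul_eq_of_mul_eq e he hee hew]

theorem IsMinimalIdempotent.const {ι τ : Type*} [SetLike τ (ι → M)] {F : τ}
    (hw : IsMinimalIdempotent E w) (hF : ∀ φ ∈ F, ∀ i, φ i ∈ E) (hwF : (fun _ => w) ∈ F) :
    IsMinimalIdempotent F (fun _ : ι => w) where
  mem := hwF
  isIdempotentElem := funext fun _ => hw.isIdempotentElem
  mul_eq_of_mul_eq φ hφ hφφ hφw := funext fun i =>
    hw.mul_eq_of_mul_eq (φ i) (hF φ hφ i) (congrFun hφφ i) (congrFun hφw i)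

end MinimalIdempotent

section RightTopological

variable {M : Type*} [TopologicalSpace M]

theorem continuous_mul_right [Mul M] [ContinuousConstSMul Mᵐᵒᵖ M] (r : M) :
    Continuous (· * r) :=
  continuous_const_smul (op r)

instance {ι : Type*} [Mul M] [ContinuousConstSMul Mᵐᵒᵖ M] :
    ContinuousConstSMul (ι → M)ᵐᵒᵖ (ι → M) where
  continuous_const_smul r :=
    continuous_pi fun i => (continuous_mul_right (unop r i)).comp (continuous_apply i)

/-- The closure, in a right topological monoid, of a submonoid whose elements have continuous left
translations. In contrast to `Submonoid.topologicalClosure`, joint continuity of the multiplication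
is not assumed, as it fails in enveloping semigroups. -/
def closureSubmonoid [Monoid M] [ContinuousConstSMul Mᵐᵒᵖ M] (S : Submonoid M)
    (hS : ∀ a ∈ S, Continuous (a * ·)) : Submonoid M where
  carrier := closure S
  one_mem' := subset_closure S.one_mem
  mul_mem' {_ b} ha hb := by
    have mul_right_mem : ∀ s ∈ S, s * b ∈ closure (S : Set M) := fun s hs =>
      map_mem_closure (hS s hs) hb fun _ ht => S.mul_mem hs ht
    simpa only [closure_closure] using map_mem_closure (continuous_mul_right b) ha mul_right_mem

variable {σ : Type*} [Semigroup M] [SetLike σ M]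

/-- Nonempty closed left ideals of the subsemigroup `E`. -/
structure IsClosedLeftIdeal (E : σ) (I : Set M) : Prop where
  subset : I ⊆ E
  nonempty : I.Nonempty
  isClosed : IsClosed I
  mul_left_mem : ∀ e ∈ E, ∀ p ∈ I, e * p ∈ I

variable [CompactSpace M] {E : σ}

theorem IsClosedLeftIdeal.sInter_of_isChain {C : Set (Set M)} (hne : C.Nonempty)
    (hchain : IsChain (· ⊆ ·) C) (hC : ∀ I ∈ C, IsClosedLeftIdeal E I) :
    IsClosedLeftIdeal E (⋂₀ C) where
  subset := (sInter_subset_of_mem hne.some_mem).trans (hC _ hne.some_mem).subset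
  nonempty := by
    have := hne.to_subtype
    exact IsCompact.nonempty_sInter_of_directed_nonempty_isCompact_isClosed
      (IsChain.directedOn hchain.symm) (fun I hI => (hC I hI).nonempty)
      (fun I hI => (hC I hI).isClosed.isCompact) (fun I hI => (hC I hI).isClosed)
  isClosed := isClosed_sInter fun I hI => (hC I hI).isClosed
  mul_left_mem e he p hp I hI := (hC I hI).mul_left_mem e he p (hp I hI)

variable [MulMemClass σ M]

theorem exists_minimal_isClosedLeftIdeal (hE : IsClosed (E : Set M))
    (hne : (E : Set M).Nonempty) : ∃ I : Set M, Minimal (IsClosedLeftIdeal E) I := by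
  have hself : IsClosedLeftIdeal E (E : Set M) :=
    ⟨Subset.rfl, hne, hE, fun _ he _ hp => mul_mem he hp⟩
  obtain ⟨I, -, hI⟩ := zorn_superset_nonempty {I : Set M | IsClosedLeftIdeal E I}
    (fun C hC hchain hCne =>
      ⟨⋂₀ C, .sInter_of_isChain hCne hchain hC, fun _ => sInter_subset_of_mem⟩) E hself
  exact ⟨I, hI⟩

variable [T2Space M] [ContinuousConstSMul Mᵐᵒᵖ M] {w : M}

theorem IsClosedLeftIdeal.image_mul_right {I : Set M} (hI : IsClosedLeftIdeal E I) {r : M}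
    (hr : r ∈ E) : IsClosedLeftIdeal E ((· * r) '' I) where
  subset := image_subset_iff.2 fun _ hp => mul_mem (hI.subset hp) hr
  nonempty := hI.nonempty.image _
  isClosed := (hI.isClosed.isCompact.image (continuous_mul_right r)).isClosed
  mul_left_mem := by
    rintro e he _ ⟨p, hp, rfl⟩
    exact ⟨e * p, hI.mul_left_mem e he p hp, mul_assoc _ _ _⟩

theorem IsMinimalIdempotent.of_mem_minimal {I : Set M} (hI : Minimal (IsClosedLeftIdeal E) I)
    (hwI : w ∈ I) (hw : IsIdempotentElem w) : IsMinimalIdempotent E w where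
  mem := hI.prop.subset hwI
  isIdempotentElem := hw
  mul_eq_of_mul_eq e he hee hew := by
    have heI : e ∈ I := hew ▸ hI.prop.mul_left_mem e he w hwI
    have hIe : (· * e) '' I = I := hI.eq_of_subset (hI.prop.image_mul_right he)
      (image_subset_iff.2 fun p hp => hI.prop.mul_left_mem p (hI.prop.subset hp) e heI)
    obtain ⟨p, -, rfl⟩ := hIe.superset hwI
    exact hee.mul_mul_self p

theorem exists_isMinimalIdempotent (hE : IsClosed (E : Set M)) (hne : (E : Set M).Nonempty) :
    ∃ w, IsMinimalIdempotent E w := by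
  obtain ⟨I, hI⟩ := exists_minimal_isClosedLeftIdeal hE hne
  obtain ⟨w, hwI, hw⟩ := exists_idempotent_in_compact_subsemigroup continuous_mul_right I
    hI.prop.nonempty hI.prop.isClosed.isCompact
    fun p hp q hq => hI.prop.mul_left_mem p (hI.prop.subset hp) q hq
  exact ⟨w, .of_mem_minimal hI hwI hw⟩

theorem IsMinimalIdempotent.exists_left_inverse (hw : IsMinimalIdempotent E w)
    (hE : IsClosed (E : Set M)) {t : M} (ht : t ∈ E) (hwt : w * t = t) (htw : t * w = t) :
    ∃ s ∈ E, w * s = s ∧ s * w = s ∧ s * t = w := by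
  obtain ⟨_, ⟨e, he, rfl⟩, het⟩ := exists_idempotent_in_compact_subsemigroup
    continuous_mul_right ((· * t) '' (E : Set M)) ⟨_, w, hw.mem, rfl⟩
    (hE.isCompact.image (continuous_mul_right t)) (by
      rintro _ ⟨a, ha, rfl⟩ _ ⟨b, hb, rfl⟩
      exact ⟨a * t * b, mul_mem (mul_mem ha ht) hb, mul_assoc _ _ _⟩)
  have hwet : w * (e * t) = w :=
    hw.mul_eq_of_mul_eq _ (mul_mem he ht) het (by rw [mul_assoc, htw])
  refine ⟨w * e * w, mul_mem (mul_mem hw.mem he) hw.mem, ?_, ?_, ?_⟩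
  · simp only [← mul_assoc, hw.isIdempotentElem.eq]
  · simp only [mul_assoc, hw.isIdempotentElem.eq]
  · rw [mul_assoc, hwt, mul_assoc, hwet]

theorem IsMinimalIdempotent.exists_inverse (hw : IsMinimalIdempotent E w)
    (hE : IsClosed (E : Set M)) {t : M} (ht : t ∈ E) (hwt : w * t = t) (htw : t * w = t) :
    ∃ s ∈ E, s * t = w ∧ t * s = w := by
  obtain ⟨s, hs, hws, hsw, hst⟩ := hw.exists_left_inverse hE ht hwt htw
  obtain ⟨r, -, -, hrw, hrs⟩ := hw.exists_left_inverse hE hs hws hsw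
  have hrt : r = t := by rw [← hrw, ← hst, ← mul_assoc, hrs, hwt]
  exact ⟨s, hs, hst, hrt ▸ hrs⟩

end RightTopological

section PointwiseTopology

variable {X : Type*} [TopologicalSpace X]

instance : TopologicalSpace (Function.End X) := inferInstanceAs (TopologicalSpace (X → X))

instance [CompactSpace X] : CompactSpace (Function.End X) :=
  inferInstanceAs (CompactSpace (X → X))

instance [T2Space X] : T2Space (Function.End X) := inferInstanceAs (T2Space (X → X))

theorem continuous_end_smul (x : X) : Continuous fun p : Function.End X => p • x :=
  continuous_apply (A := fun _ : X => X) x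

instance : ContinuousConstSMul (Function.End X)ᵐᵒᵖ (Function.End X) where
  continuous_const_smul r :=
    continuous_pi (A := fun _ : X => X) fun x => continuous_end_smul (unop r x)

theorem continuous_end_mul_left {a : Function.End X} (ha : Continuous (a • · : X → X)) :
    Continuous (a * ·) :=
  continuous_pi (A := fun _ : X => X) fun x => ha.comp (continuous_end_smul x)

theorem continuous_pi_end_smul {ι : Type*} (c : ι → X) :
    Continuous fun φ : ι → Function.End X => φ • c :=
  continuous_pi fun i => (continuous_end_smul (c i)).comp (continuous_apply i)

end PointwiseTopology

section Cube

variable {X Y : Type*} {n : ℕ}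

theorem lowerCorner_self (x : X) : lowerCorner n x x = fun _ => x :=
  funext fun _ => ite_self x

theorem lowerCorner_eq_update (x y : X) :
    lowerCorner n x y = update (fun _ => x) (fun _ => true) y := by
  funext ω
  simp only [lowerCorner, update_apply]

theorem comp_lowerCorner (f : X → Y) (x y : X) :
    f ∘ lowerCorner n x y = lowerCorner n (f x) (f y) :=
  funext fun _ => apply_ite f _ _ _

theorem lowerCorner_smul_lowerCorner {M : Type*} [SMul M X] (p q : M) (x y : X) :
    lowerCorner n p q • lowerCorner n x y = lowerCorner n (p • x) (q • y) :=
  funext fun ω => by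
    simp only [Pi.smul_apply', lowerCorner]
    split_ifs <;> rfl

/-- The symmetry of the discrete cube that carries the vertex `v` to `(1, …, 1)`, flipping the
coordinates at which `v` vanishes. -/
def reflect (v : Cube n) (ω : Cube n) : Cube n := fun i => ω i == v i

theorem reflect_eq_top_iff {v ω : Cube n} : reflect v ω = (fun _ => true) ↔ ω = v := by
  simp only [reflect, funext_iff, beq_iff_eq]

theorem lowerCorner_comp_reflect (x y : X) (v : Cube n) :
    lowerCorner n x y ∘ reflect v = update (fun _ => x) v y := by
  funext ω
  simp only [lowerCorner, comp_apply, reflect_eq_top_iff, update_apply]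

variable {G : Type*} [Group G]

theorem faceElement_hyperface_comp_reflect (v : Cube n) (i : Fin n) (a : Bool) (h : G) :
    faceElement (hyperface i a) h ∘ reflect v = faceElement (hyperface i (a == v i)) h := by
  funext ω
  have : reflect v ω ∈ hyperface i a ↔ ω ∈ hyperface i (a == v i) := by
    change (ω i == v i) = a ↔ ω i = (a == v i)
    cases ω i <;> cases v i <;> cases a <;> decide
  classical exact if_congr this rfl rfl

theorem comp_reflect_mem_hostKraGroup (v : Cube n) {γ : Cube n → G} (hγ : γ ∈ hostKraGroup G n) :
    γ ∘ reflect v ∈ hostKraGroup G n := by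
  induction hγ using Subgroup.closure_induction with
  | mem _ hx =>
    obtain ⟨i, a, h, rfl⟩ := hx
    exact Subgroup.subset_closure ⟨i, a == v i, h, faceElement_hyperface_comp_reflect v i a h⟩
  | one => exact one_mem _
  | mul _ _ _ _ hx hy => exact mul_mem hx hy
  | inv _ _ hx => exact inv_mem hx

end Cube

section DynamicalCubes

variable {G X Y : Type*} [Group G] [TopologicalSpace X] [MulAction G X] [TopologicalSpace Y]
  [MulAction G Y] {n d : ℕ}

theorem const_mem_dynamicalCubes (x : X) : (fun _ => x) ∈ dynamicalCubes G X n :=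
  subset_closure ⟨1, one_mem _, x, by simp only [Pi.one_apply, one_smul]⟩

theorem comp_reflect_mem_dynamicalCubes (v : Cube n) {c : Cube n → X}
    (hc : c ∈ dynamicalCubes G X n) : c ∘ reflect v ∈ dynamicalCubes G X n := by
  refine map_mem_closure (f := (· ∘ reflect v)) (by fun_prop) hc ?_
  rintro _ ⟨γ, hγ, x, rfl⟩
  exact ⟨γ ∘ reflect v, comp_reflect_mem_hostKraGroup v hγ, x, rfl⟩

theorem NRP.refl (d : ℕ) (x : X) : NRP G X d x x := by
  rw [NRP, lowerCorner_self]
  exact const_mem_dynamicalCubes x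

theorem NRP.update_const_mem {x y : X} (h : NRP G X d x y) (v : Cube (d + 1)) :
    update (fun _ => x) v y ∈ dynamicalCubes G X (d + 1) :=
  lowerCorner_comp_reflect x y v ▸ comp_reflect_mem_dynamicalCubes v h

theorem isClosed_NRP (d : ℕ) : IsClosed {q : X × X | NRP G X d q.1 q.2} := by
  refine isClosed_closure.preimage (f := fun q : X × X => lowerCorner (d + 1) q.1 q.2) ?_
  simp only [lowerCorner_eq_update]
  fun_prop

end DynamicalCubes

section EnvelopingSemigroup

variable (G X : Type*) [Group G] [TopologicalSpace X] [MulAction G X] [ContinuousConstSMul G X]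

/-- The enveloping (Ellis) semigroup of `(G, X)`: the pointwise closure of the translations by
elements of `G` in the monoid of all self-maps of `X`. -/
def ellis : Submonoid (Function.End X) :=
  closureSubmonoid (MonoidHom.mrange (MulAction.toEndHom : G →* Function.End X)) (by
    rintro _ ⟨g, rfl⟩
    exact continuous_end_mul_left (continuous_const_smul g))

/-- The enveloping semigroup of the Host–Kra cube group acting on `X^{[n]}`. Its elements act
coordinatewise, so they are encoded as tuples of self-maps of `X`. -/
def cubeEllis (n : ℕ) : Submonoid (Cube n → Function.End X) :=
  closureSubmonoid
    ((hostKraGroup G n).toSubmonoid.map (MulAction.toEndHom.compLeft (Cube n))) (by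
      rintro _ ⟨γ, -, rfl⟩
      exact continuous_pi fun ω => (continuous_end_mul_left
        (continuous_const_smul (γ ω))).comp (continuous_apply ω))

theorem isClosed_ellis : IsClosed (ellis G X : Set (Function.End X)) := isClosed_closure

theorem isClosed_cubeEllis (n : ℕ) : IsClosed (cubeEllis G X n : Set (Cube n → Function.End X)) :=
  isClosed_closure

variable {G X} {n d : ℕ}

theorem toEndHom_comp_mem_cubeEllis {γ : Cube n → G} (hγ : γ ∈ hostKraGroup G n) :
    MulAction.toEndHom ∘ γ ∈ cubeEllis G X n :=
  subset_closure ⟨γ, hγ, rfl⟩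

theorem apply_mem_ellis {φ : Cube n → Function.End X} (hφ : φ ∈ cubeEllis G X n) (ω : Cube n) :
    φ ω ∈ ellis G X := by
  refine map_mem_closure (f := fun φ : Cube n → Function.End X => φ ω) (continuous_apply ω) hφ ?_
  rintro _ ⟨γ, -, rfl⟩
  exact ⟨γ ω, rfl⟩

theorem const_mem_cubeEllis {p : Function.End X} (hp : p ∈ ellis G X) :
    (fun _ => p) ∈ cubeEllis G X (n + 1) := by
  refine map_mem_closure (f := fun p _ => p) (by fun_prop) hp ?_
  rintro _ ⟨g, rfl⟩
  exact ⟨fun _ => g, const_mem_hostKraGroup n g, rfl⟩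

theorem IsMinimalIdempotent.const_cubeEllis {w : Function.End X}
    (hw : IsMinimalIdempotent (ellis G X) w) (n : ℕ) :
    IsMinimalIdempotent (cubeEllis G X (n + 1)) (fun _ => w) :=
  hw.const (fun _ hφ => apply_mem_ellis hφ) (const_mem_cubeEllis hw.mem)

theorem ite_coord_mem_cubeEllis (i : Fin n) {p : Function.End X} (hp : p ∈ ellis G X) :
    (fun ω => if ω i = false then p else 1) ∈ cubeEllis G X n := by
  refine map_mem_closure (f := fun p (ω : Cube n) => if ω i = false then p else 1)
    (continuous_pi fun ω => by split_ifs <;> fun_prop) hp ?_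
  rintro _ ⟨g, rfl⟩
  refine ⟨faceElement (hyperface i false) g, Subgroup.subset_closure ⟨i, false, g, rfl⟩, ?_⟩
  funext ω
  by_cases h : ω i = false <;> simp [faceElement, hyperface, h]

theorem ite_exists_coord_mem_cubeEllis (s : Finset (Fin n)) {w : Function.End X}
    (hwE : w ∈ ellis G X) (hw : IsIdempotentElem w) :
    (fun ω => if ∃ i ∈ s, ω i = false then w else 1) ∈ cubeEllis G X n := by
  induction s using Finset.induction_on with
  | empty => simp [← Pi.one_def]
  | insert i s _ ih =>
    convert mul_mem (ite_coord_mem_cubeEllis i hwE) ih using 1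
    funext ω
    by_cases hi : ω i = false <;> by_cases hs : ∃ j ∈ s, ω j = false <;> simp [hi, hs, hw.eq]

theorem lowerCorner_one_mem_cubeEllis {w : Function.End X} (hwE : w ∈ ellis G X)
    (hw : IsIdempotentElem w) : lowerCorner n w 1 ∈ cubeEllis G X n := by
  convert ite_exists_coord_mem_cubeEllis Finset.univ hwE hw using 1
  funext ω
  have : (∃ i ∈ Finset.univ, ω i = false) ↔ ω ≠ fun _ => true := by
    simp [funext_iff]
  simp only [lowerCorner, this, ite_not]

theorem smul_mem_dynamicalCubes {φ : Cube n → Function.End X} (hφ : φ ∈ cubeEllis G X n)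
    {c : Cube n → X} (hc : c ∈ dynamicalCubes G X n) : φ • c ∈ dynamicalCubes G X n := by
  have hostKra_smul_mem : ∀ γ ∈ hostKraGroup G n, γ • c ∈ dynamicalCubes G X n := by
    intro γ hγ
    refine map_mem_closure (f := fun c : Cube n → X => γ • c)
      (continuous_pi fun ω => (continuous_apply ω).const_smul (γ ω)) hc ?_
    rintro _ ⟨δ, hδ, x, rfl⟩
    exact ⟨γ * δ, mul_mem hγ hδ, x, funext fun ω => (mul_smul (γ ω) (δ ω) x).symm⟩
  have hcl : φ • c ∈ closure (dynamicalCubes G X n) := by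
    refine map_mem_closure (f := fun φ : Cube n → Function.End X => φ • c)
      (continuous_pi_end_smul c) hφ ?_
    rintro _ ⟨γ, hγ, rfl⟩
    exact hostKra_smul_mem γ hγ
  rwa [dynamicalCubes, closure_closure] at hcl

theorem NRP.ellis_smul {x y : X} (h : NRP G X d x y) {p : Function.End X} (hp : p ∈ ellis G X) :
    NRP G X d (p • x) (p • y) := by
  rw [NRP, ← comp_lowerCorner (p • ·)]
  exact smul_mem_dynamicalCubes (const_mem_cubeEllis hp) h

end EnvelopingSemigroup

section MinimalSystem

variable {G X : Type*} [Group G] [TopologicalSpace X] [CompactSpace X] [T2Space X] [MulAction G X]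
  [ContinuousConstSMul G X]

theorem image_ellis_smul_eq_closure_orbit (x : X) :
    (fun p : Function.End X => p • x) '' (ellis G X) = closure (MulAction.orbit G x) := by
  have hcompact := (isClosed_ellis G X).isCompact
  refine (image_closure_of_isCompact hcompact (continuous_end_smul x).continuousOn).trans ?_
  rw [MonoidHom.coe_mrange, ← range_comp]
  rfl

variable [MulAction.IsMinimal G X] {n d : ℕ} {w : Function.End X}

theorem exists_ellis_smul_eq (x y : X) : ∃ p ∈ ellis G X, p • x = y :=
  (image_ellis_smul_eq_closure_orbit x).superset (MulAction.dense_orbit G x y)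

theorem exists_cubeEllis_smul_const_eq (x : X) {c : Cube (n + 1) → X}
    (hc : c ∈ dynamicalCubes G X (n + 1)) :
    ∃ t ∈ cubeEllis G X (n + 1), (t • fun _ => x) = c := by
  have hcl : IsClosed ((fun t : Cube (n + 1) → Function.End X => t • fun _ => x) ''
      (cubeEllis G X (n + 1))) :=
    ((isClosed_cubeEllis G X (n + 1)).isCompact.image (continuous_pi_end_smul _)).isClosed
  refine closure_minimal ?_ hcl hc
  rintro _ ⟨γ, hγ, z, rfl⟩
  obtain ⟨p, hp, rfl⟩ := exists_ellis_smul_eq (G := G) x z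
  exact ⟨_, mul_mem (toEndHom_comp_mem_cubeEllis hγ) (const_mem_cubeEllis hp), rfl⟩

theorem exists_isIdempotentElem_mul_eq_and_smul_eq (hwE : w ∈ ellis G X)
    (hw : IsIdempotentElem w) (x : X) :
    ∃ v ∈ ellis G X, IsIdempotentElem v ∧ v * w = v ∧ v • x = x := by
  obtain ⟨p, hp, hpx⟩ := exists_ellis_smul_eq (G := G) (w • x) x
  obtain ⟨v, ⟨hvE, hvw, hvx⟩, hv⟩ := exists_idempotent_in_compact_subsemigroup
    continuous_mul_right {q : Function.End X | q ∈ ellis G X ∧ q * w = q ∧ q • x = x}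
    ⟨p * w, mul_mem hp hwE, hw.mul_mul_self p, hpx⟩
    ((isClosed_ellis G X).inter ((isClosed_eq (continuous_mul_right w) continuous_id).inter
      (isClosed_singleton.preimage (continuous_end_smul x)))).isCompact
    (by
      rintro q ⟨hq, -, hqx⟩ r ⟨hr, hrw, hrx⟩
      exact ⟨mul_mem hq hr, by rw [mul_assoc, hrw], by rw [mul_smul, hrx, hqx]⟩)
  exact ⟨v, hvE, hv, hvw, hvx⟩

variable (G) in
theorem exists_isMinimalIdempotent_smul_eq (x : X) :
    ∃ w, IsMinimalIdempotent (ellis G X) w ∧ w • x = x := by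
  obtain ⟨w, hw⟩ := exists_isMinimalIdempotent (isClosed_ellis G X) ⟨1, one_mem (ellis G X)⟩
  obtain ⟨v, hvE, hv, hvw, hvx⟩ :=
    exists_isIdempotentElem_mul_eq_and_smul_eq hw.mem hw.isIdempotentElem x
  exact ⟨v, hw.of_mul_eq hvE hv hvw, hvx⟩

theorem IsMinimalIdempotent.exists_inverse_smul_const_eq (hw : IsMinimalIdempotent (ellis G X) w)
    {c : Cube (n + 1) → X} (hc : c ∈ dynamicalCubes G X (n + 1)) (hwc : ∀ ω, w • c ω = c ω) {y : X}
    (hwy : w • y = y) :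
    ∃ t ∈ cubeEllis G X (n + 1), ∃ s ∈ cubeEllis G X (n + 1),
      (∀ ω, s ω * t ω = w) ∧ (∀ ω, t ω * s ω = w) ∧ ∀ ω, t ω • y = c ω := by
  have hW := hw.const_cubeEllis n
  obtain ⟨r, hr, hrc⟩ := exists_cubeEllis_smul_const_eq (G := G) y hc
  have ht := mul_mem (mul_mem hW.mem hr) hW.mem
  obtain ⟨s, hs, hst, hts⟩ := hW.exists_inverse (isClosed_cubeEllis G X (n + 1)) ht
    (funext fun ω => by simp only [Pi.mul_apply, ← mul_assoc, hw.isIdempotentElem.eq])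
    (funext fun ω => by simp only [Pi.mul_apply, mul_assoc, hw.isIdempotentElem.eq])
  refine ⟨_, ht, s, hs, congrFun hst, congrFun hts, fun ω => ?_⟩
  have hry : r ω • y = c ω := congrFun hrc ω
  simp only [Pi.mul_apply, mul_smul, hwy, hry, hwc]

theorem IsMinimalIdempotent.update_mem_dynamicalCubes (hw : IsMinimalIdempotent (ellis G X) w)
    {c : Cube (d + 1) → X} (hc : c ∈ dynamicalCubes G X (d + 1)) (hwc : ∀ ω, w • c ω = c ω)
    (v : Cube (d + 1)) {y : X} (hwy : w • y = y) (h : NRP G X d (c v) y) :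
    update c v y ∈ dynamicalCubes G X (d + 1) := by
  obtain ⟨t, ht, s, hs, hst, hts, htc⟩ := hw.exists_inverse_smul_const_eq hc hwc hwy
  have hscv : s v • c v = y := by rw [← htc, ← mul_smul, hst, hwy]
  have hpair : NRP G X d y (s v • y) := by
    simpa only [hscv] using h.ellis_smul (apply_mem_ellis hs v)
  have hupdate : t • update (fun _ => y) v (s v • y) = update c v y := by
    funext ω
    rw [Pi.smul_apply']
    rcases eq_or_ne ω v with rfl | hω
    · rw [update_self, update_self, ← mul_smul, hts, hwy]
    · rw [update_of_ne hω, update_of_ne hω, htc]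
  exact hupdate ▸ smul_mem_dynamicalCubes ht (hpair.update_const_mem v)

theorem IsMinimalIdempotent.mem_dynamicalCubes_of_forall_NRP
    (hw : IsMinimalIdempotent (ellis G X) w) {b c : Cube (d + 1) → X}
    (hc : c ∈ dynamicalCubes G X (d + 1)) (hwc : ∀ ω, w • c ω = c ω) (hwb : ∀ ω, w • b ω = b ω)
    (h : ∀ ω, NRP G X d (c ω) (b ω)) : b ∈ dynamicalCubes G X (d + 1) := by
  suffices ∀ s : Finset (Cube (d + 1)), s.piecewise b c ∈ dynamicalCubes G X (d + 1) by
    simpa only [Finset.piecewise_univ] using this Finset.univ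
  intro s
  induction s using Finset.induction_on with
  | empty => simpa only [Finset.piecewise_empty] using hc
  | insert v s hv ih =>
    rw [Finset.piecewise_insert]
    refine hw.update_mem_dynamicalCubes ih (fun ω => ?_) v (hwb v) ?_
    · exact s.piecewise_cases b c (fun z => w • z = z) (hwb ω) (hwc ω)
    · rw [s.piecewise_eq_of_notMem b c hv]
      exact h v

theorem IsMinimalIdempotent.NRP_of_NRP_smul (hw : IsMinimalIdempotent (ellis G X) w) {x y : X}
    (hwx : w • x = x) (h : NRP G X d x (w • y)) : NRP G X d x y := by
  obtain ⟨v, hvE, hv, hvw, hvy⟩ :=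
    exists_isIdempotentElem_mul_eq_and_smul_eq hw.mem hw.isIdempotentElem y
  have hwv : w * v = w := hw.mul_eq_of_mul_eq v hvE hv hvw
  have hvx : NRP G X d (v • x) y := by
    simpa only [← mul_smul, hvw, hvy] using h.ellis_smul hvE
  have hcube := smul_mem_dynamicalCubes
    (lowerCorner_one_mem_cubeEllis hw.mem hw.isIdempotentElem) hvx
  rwa [lowerCorner_smul_lowerCorner, ← mul_smul, hwv, hwx, one_smul] at hcube

theorem NRP_of_forall_NRP_lowerCorner {x y : X} {c : Cube (d + 1) → X}
    (hc : c ∈ dynamicalCubes G X (d + 1))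
    (h : ∀ ω, NRP G X d (c ω) (lowerCorner (d + 1) x y ω)) : NRP G X d x y := by
  obtain ⟨w, hw, hwx⟩ := exists_isMinimalIdempotent_smul_eq G x
  have hww : ∀ z : X, w • w • z = w • z := fun z => by rw [← mul_smul, hw.isIdempotentElem.eq]
  refine hw.NRP_of_NRP_smul hwx ?_
  have hcorner : lowerCorner (d + 1) x (w • y) = fun ω => w • lowerCorner (d + 1) x y ω := by
    conv_lhs => rw [← hwx]
    exact (comp_lowerCorner (w • ·) x y).symm
  rw [NRP, hcorner]
  exact hw.mem_dynamicalCubes_of_forall_NRP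
    (smul_mem_dynamicalCubes (const_mem_cubeEllis hw.mem) hc)
    (fun ω => hww (c ω)) (fun ω => hww _) fun ω => (h ω).ellis_smul hw.mem

theorem NRP.symm {x y : X} (h : NRP G X d x y) : NRP G X d y x := by
  refine NRP_of_forall_NRP_lowerCorner (const_mem_dynamicalCubes x) fun ω => ?_
  rw [lowerCorner]
  split_ifs
  exacts [NRP.refl d x, h]

theorem NRP.trans {x y z : X} (hxy : NRP G X d x y) (hyz : NRP G X d y z) : NRP G X d x z := by
  refine NRP_of_forall_NRP_lowerCorner hxy fun ω => ?_
  rw [lowerCorner, lowerCorner]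
  split_ifs
  exacts [hyz, NRP.refl d x]

variable (G X) in
theorem equivalence_NRP (d : ℕ) : Equivalence (NRP G X d) :=
  ⟨NRP.refl d, NRP.symm, NRP.trans⟩

end MinimalSystem

section Factor

variable {G X Y : Type*} [Group G] [TopologicalSpace X] [MulAction G X] [TopologicalSpace Y]
  [MulAction G Y] {φ : X → Y} {n d : ℕ}

theorem IsFactorMap.comp_mem_dynamicalCubes (hφ : IsFactorMap G φ) {c : Cube n → X}
    (hc : c ∈ dynamicalCubes G X n) : φ ∘ c ∈ dynamicalCubes G Y n := by
  have := hφ.continuous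
  refine map_mem_closure (f := fun c : Cube n → X => φ ∘ c) (by fun_prop) hc ?_
  rintro _ ⟨γ, hγ, x, rfl⟩
  exact ⟨γ, hγ, φ x, funext fun ω => hφ.map_smul _ _⟩

theorem IsFactorMap.nrp_map (hφ : IsFactorMap G φ) {x y : X} (h : NRP G X d x y) :
    NRP G Y d (φ x) (φ y) := by
  rw [NRP, ← comp_lowerCorner]
  exact hφ.comp_mem_dynamicalCubes h

theorem IsFactorMap.exists_mem_dynamicalCubes_comp_eq [CompactSpace X] [T2Space Y]
    (hφ : IsFactorMap G φ) {b : Cube n → Y} (hb : b ∈ dynamicalCubes G Y n) :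
    ∃ c ∈ dynamicalCubes G X n, φ ∘ c = b := by
  have hφc := hφ.continuous
  have hcl : IsClosed ((fun c : Cube n → X => φ ∘ c) '' dynamicalCubes G X n) :=
    (isClosed_closure.isCompact.image (by fun_prop)).isClosed
  refine closure_minimal ?_ hcl hb
  rintro _ ⟨γ, hγ, y, rfl⟩
  obtain ⟨x, rfl⟩ := hφ.surjective y
  exact ⟨_, subset_closure ⟨γ, hγ, x, rfl⟩, funext fun ω => hφ.map_smul _ _⟩

theorem IsFactorMap.continuousSMul [TopologicalSpace G] [CompactSpace X] [ContinuousSMul G X]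
    [T2Space Y] (hφ : IsFactorMap G φ) : ContinuousSMul G Y := by
  have hquot : Topology.IsQuotientMap (Prod.map (id : G → G) φ) :=
    (isProperMap_id.prodMap hφ.continuous.isProperMap).isClosedMap.isQuotientMap
      (continuous_id.prodMap hφ.continuous) (surjective_id.prodMap hφ.surjective)
  have hsmul : (fun p : G × Y => p.1 • p.2) ∘ Prod.map id φ = fun p => φ (p.1 • p.2) :=
    funext fun p => (hφ.map_smul p.1 p.2).symm
  refine ⟨hquot.continuous_iff.2 ?_⟩
  rw [hsmul]
  exact hφ.continuous.comp continuous_smul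

end Factor

section Quotient

theorem isClosedMap_quotient_mk {X : Type*} [TopologicalSpace X] [CompactSpace X] {r : Setoid X}
    (hr : IsClosed {q : X × X | r q.1 q.2}) : IsClosedMap (Quotient.mk r) := by
  intro F hF
  have hsaturation : Quotient.mk r ⁻¹' (Quotient.mk r '' F)
      = Prod.snd '' ({q : X × X | r q.1 q.2} ∩ Prod.fst ⁻¹' F) := by
    ext y
    constructor
    · rintro ⟨x, hx, hxy⟩
      exact ⟨(x, y), ⟨Quotient.exact hxy, hx⟩, rfl⟩
    · rintro ⟨⟨x, _⟩, ⟨hxy, hx⟩, rfl⟩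
      exact ⟨x, hx, Quotient.sound hxy⟩
  refine isQuotientMap_quotient_mk'.isClosed_preimage.1 (?_ : IsClosed (Quotient.mk r ⁻¹' _))
  rw [hsaturation]
  exact isClosedMap_snd_of_compactSpace _ (hr.inter (hF.preimage continuous_fst))

theorem t2Space_quotient_of_isClosed {X : Type*} [TopologicalSpace X] [CompactSpace X]
    {r : Setoid X} (hr : IsClosed {q : X × X | r q.1 q.2}) : T2Space (Quotient r) := by
  have hfiber : ∀ a, IsCompact (Quotient.mk r ⁻¹' {a}) := by
    rintro ⟨x⟩
    have hclass : Quotient.mk r ⁻¹' {Quotient.mk r x} = {y | r y x} :=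
      Set.ext fun _ => Quotient.eq
    exact hclass ▸ (hr.preimage (by fun_prop : Continuous fun y => (y, x))).isCompact
  have hproper : IsProperMap (Quotient.mk r) := isProperMap_iff_isClosedMap_and_compact_fibers.2
    ⟨continuous_quotient_mk', isClosedMap_quotient_mk hr, hfiber⟩
  have hdiagonal : diagonal (Quotient r)
      = Prod.map (Quotient.mk r) (Quotient.mk r) '' {q : X × X | r q.1 q.2} := by
    ext ⟨a, b⟩
    constructor
    · rintro (rfl : a = b)
      obtain ⟨x, rfl⟩ := Quotient.exists_rep a
      exact ⟨(x, x), r.refl x, rfl⟩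
    · rintro ⟨⟨x, y⟩, hxy, h⟩
      obtain ⟨rfl, rfl⟩ := Prod.mk.inj h
      exact Quotient.sound hxy
  rw [t2_iff_isClosed_diagonal, hdiagonal]
  exact (hproper.prodMap hproper).isClosedMap _ hr

variable {G X Y : Type*} [Group G] [TopologicalSpace X] [MulAction G X] [TopologicalSpace Y]
  [MulAction G Y] {d : ℕ}

theorem NRPQuotient.mk_eq_mk_iff (h : Equivalence (NRP G X d)) {x y : X} :
    NRPQuotient.mk h x = NRPQuotient.mk h y ↔ NRP G X d x y :=
  Quotient.eq (r := Setoid.mk _ h)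

theorem NRPQuotient.t2Space [CompactSpace X] (h : Equivalence (NRP G X d)) :
    T2Space (NRPQuotient h) :=
  t2Space_quotient_of_isClosed (r := Setoid.mk _ h) (isClosed_NRP d)

variable [ContinuousConstSMul G X]

theorem NRPQuotient.isFactorMap_mk (h : Equivalence (NRP G X d)) :
    IsFactorMap G (NRPQuotient.mk h) :=
  ⟨continuous_quotient_mk', fun _ _ => rfl, Quotient.exists_rep⟩

theorem NRPQuotient.isOfOrderAtMost [CompactSpace X] [T2Space X] [MulAction.IsMinimal G X]
    (h : Equivalence (NRP G X d)) : IsOfOrderAtMost G (NRPQuotient h) d := by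
  have := NRPQuotient.t2Space h
  have hπ := NRPQuotient.isFactorMap_mk h
  refine fun a b => ⟨fun hab => ?_, fun hab => hab ▸ NRP.refl d a⟩
  obtain ⟨x, rfl⟩ := hπ.surjective a
  obtain ⟨y, rfl⟩ := hπ.surjective b
  obtain ⟨c, hc, hπc⟩ := hπ.exists_mem_dynamicalCubes_comp_eq hab
  rw [← comp_lowerCorner] at hπc
  exact (mk_eq_mk_iff h).2 <| NRP_of_forall_NRP_lowerCorner hc fun ω =>
    (mk_eq_mk_iff h).1 (congrFun hπc ω)

theorem IsFactorMap.exists_isFactorMap_comp_mk {φ : X → Y} (hφ : IsFactorMap G φ)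
    (hY : IsOfOrderAtMost G Y d) (h : Equivalence (NRP G X d)) :
    ∃ ψ : NRPQuotient h → Y, IsFactorMap G ψ ∧ φ = ψ ∘ NRPQuotient.mk h := by
  have hφ_eq : ∀ x y, NRP G X d x y → φ x = φ y := fun x y hxy => (hY _ _).1 (hφ.nrp_map hxy)
  refine ⟨Quotient.lift (s := Setoid.mk _ h) φ hφ_eq, ⟨?_, ?_, ?_⟩, rfl⟩
  · exact hφ.continuous.quotient_lift (s := Setoid.mk _ h) hφ_eq
  · rintro g ⟨x⟩
    exact hφ.map_smul g x
  · exact Quotient.lift_surjective (s := Setoid.mk _ h) φ hφ_eq hφ.surjective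

end Quotient

end NilRP

theorem mainTheorem5_general {G X : Type*} [Group G] [TopologicalSpace X] [CompactSpace X]
    [T2Space X] [MulAction G X] [ContinuousConstSMul G X] [MulAction.IsMinimal G X] (d : ℕ) :
    ∃ h : Equivalence (NilRP.NRP G X d),
      CompactSpace (NilRP.NRPQuotient h) ∧
      T2Space (NilRP.NRPQuotient h) ∧
      (∀ [TopologicalSpace G] [ContinuousSMul G X], ContinuousSMul G (NilRP.NRPQuotient h)) ∧
      NilRP.IsFactorMap G (NilRP.NRPQuotient.mk h) ∧
      NilRP.IsOfOrderAtMost G (NilRP.NRPQuotient h) d ∧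
      ∀ (Y : Type*) [TopologicalSpace Y] [MulAction G Y] (φ : X → Y),
        NilRP.IsFactorMap G φ → NilRP.IsOfOrderAtMost G Y d →
          ∃ ψ : NilRP.NRPQuotient h → Y,
            NilRP.IsFactorMap G ψ ∧ φ = ψ ∘ NilRP.NRPQuotient.mk h := by
  have h := NilRP.equivalence_NRP G X d
  have hπ := NilRP.NRPQuotient.isFactorMap_mk h
  have hT2 := NilRP.NRPQuotient.t2Space h
  exact ⟨h, Quotient.compactSpace (s := Setoid.mk _ h), hT2, hπ.continuousSMul, hπ,
    NilRP.NRPQuotient.isOfOrderAtMost h, fun Y _ _ φ hφ hY => hφ.exists_isFactorMap_comp_mk hY h⟩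

theorem mainTheorem5 {G : Type*} {X : Type*}
    [Group G] [TopologicalSpace G] [IsTopologicalGroup G] [T2Space G]
    [TopologicalSpace X] [CompactSpace X] [T2Space X]
    [MulAction G X] [ContinuousSMul G X] [MulAction.IsMinimal G X]
    (d : ℕ) (hd : 1 ≤ d) :
    ∃ h : Equivalence (NilRP.NRP G X d),
      CompactSpace (NilRP.NRPQuotient h) ∧
      T2Space (NilRP.NRPQuotient h) ∧
      ContinuousSMul G (NilRP.NRPQuotient h) ∧
      NilRP.IsFactorMap G (NilRP.NRPQuotient.mk h) ∧
      NilRP.IsOfOrderAtMost G (NilRP.NRPQuotient h) d ∧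
      ∀ (Y : Type*) [TopologicalSpace Y] [CompactSpace Y] [T2Space Y]
        [MulAction G Y] [ContinuousSMul G Y] (φ : X → Y),
        NilRP.IsFactorMap G φ → NilRP.IsOfOrderAtMost G Y d →
          ∃ ψ : NilRP.NRPQuotient h → Y,
            NilRP.IsFactorMap G ψ ∧ φ = ψ ∘ NilRP.NRPQuotient.mk h := by
  obtain ⟨h, hcompact, hT2, hcont, hπ, horder, hmax⟩ := mainTheorem5_general (G := G) (X := X) d
  exact ⟨h, hcompact, hT2, hcont, hπ, horder, fun Y _ _ _ _ _ φ hφ hY => hmax Y φ hφ hY⟩
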